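/- **Conventions.** Let $X$ be a complex $*$-vector space, $\mathbb N=\{1,2,\dots\}$, and let $M_{l,m}(X)$ be the $l\times m$ matrices over $X$, with $M_n(X)=M_{n,n}(X)$, $(x^*)_{ij}=(x_{ji})^*$, $M_n(X)_{sa}=\{x\in M_n(X): x=x^*\}$, and the obvious left and right multiplication by scalar matrices (with operator norm). Write $x\oplus y$ for the block diagonal matrix with blocks $x,y$, and $x^n=x\oplus\cdots\oplus x$ ($n$ summands). An *absolute matrix order unit space* is $X$ together with convex cones $M_n(X)^+\subseteq M_n(X)_{sa}$ (with $u\le v$ meaning $v-u\in M_n(X)^+$), maps $|\cdot|_{l,m}:M_{l,m}(X)\to M_m(X)^+$ (written $|\cdot|$) and an element $e\in X^+=M_1(X)^+$ such that: 1. $a^*va\in M_m(X)^+$ for $v\in M_n(X)^+$, $a\in M_{n,m}(\mathbb C)$; $e$ is an order unit of $X_{sa}$; $X^+\cap(-X^+)=\{0\}$; every $M_n(X)^+$ is Archimedean (if $u\in M_n(X)^+$, $v\in M_n(X)_{sa}$ and $ku+v\in M_n(X)^+$ for all real $k>0$, then $v\in M_n(X)^+$). 2. On each $M_n(X)_{sa}$,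 writing $u\perp v$ for $|u-v|=u+v$: $|v|=v$ if $v\ge0$; $\pm v\le |v|$; $|kv|=|k||v|$ for $k\in\mathbb R$; if $u\perp v$ and $0\le w\le v$ then $u\perp w$; if $u\perp v$ and $u\perp w$ then $u\perp|v\pm w|$. 3. $|axb|\le\|a\|\,\big||x|b\big|$ for scalar matrices $a,b$ of suitable sizes, and $|x\oplus y|=|x|\oplus|y|$. 4. With $\|y\|_n=\inf\{\epsilon>0:\begin{bmatrix}\epsilon e^n&y\\y^*&\epsilon e^n\end{bmatrix}\in M_{2n}(X)^+\}$, for $u,v\in M_n(X)^+$ one has $u\perp v$ if and only if $\|\alpha u_1+\beta v_1\|_n=\max\{\|\alpha u_1\|_n,\|\beta v_1\|_n\}$ for all $0\le u_1\le u$, $0\le v_1\le v$ and $\alpha,\beta\in\mathbb R$. An *order projection* is $p\in M_n(X)_{sa}$ with $|2p-e^n|=e^n$; $\mathrm{OP}_n(X)$ is the set of these and $\mathrm{OP}_\infty(X)=\bigsqcup_n \mathrm{OP}_n(X)$. A *partial isometry* is $v\in M_{m,n}(X)$ such that $|v|$ and $|v^*|$ are order projections. *Condition (T)*: if $u\in M_{m,n}(X)$,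 $v\in M_{l,n}(X)$ are partial isometries with $|u|=|v|$, there is a partial isometry $w\in M_{m,l}(X)$ with $|w^*|=|u^*|$ and $|w|=|v^*|$. For $p\in \mathrm{OP}_m(X)$, $q\in\mathrm{OP}_n(X)$ write $p\sim q$ if $p=|v^*|$, $q=|v|$ for some $v\in M_{m,n}(X)$, and $p\approx q$ if $p\oplus r\sim q\oplus r$ for some $r\in\mathrm{OP}_\infty(X)$. If (T) holds, $K_0(X)$ is the Grothendieck group of the commutative monoid $(\mathrm{OP}_\infty(X)/{\sim},\oplus)$, that is, the set of classes $[(p,q)]$ of pairs of order projections, where $[(p,q)]=[(r,s)]$ if and only if $p\oplus s\approx r\oplus q$, with $[(p,q)]+[(r,s)]=[(p\oplus r,q\oplus s)]$. An element $x\in X^+$ has the *absolute matrix order unit property* if, for every $n$, $|y|\le\|y\|_n x^n$ for every $y\in M_n(X)_{sa}$ with $\pm y\le\epsilon x^n$ for some $\epsilon>0$. For such $x$ with $\|x\|=1$, the subspace $$X_x=\Big\{y\in X:\begin{bmatrix}\epsilon x&y\\y^*&\epsilon x\end{bmatrix}\in M_2(X)^+\text{ for some }\epsilon>0\Big\},$$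 with the cones $M_n(X)^+\cap M_n(X_x)$, the absolute values of $X$ and the order unit $x$, is an absolute matrix order unit space. **Theorem.** Let $X$ be an absolute matrix order unit space in which (T) holds, and let $x\in X^+$ with $\|x\|=1$ have the absolute matrix order unit property. Then (T) holds in $X_x$, every order projection of $X_x$ is an order projection of $X$, and $[(p,q)]\mapsto[(p,q)]$ defines a group homomorphism $K_0(X_x)\to K_0(X)$. If moreover, for all $p,q\in\mathrm{OP}_\infty(X_x)$, $p\approx q$ in $X$ implies $p\approx q$ in $X_x$, then this homomorphism is injective. -/

import Mathlib

open Matrix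
open scoped Matrix.Norms.L2Operator

namespace AMOU

/-- The index set `{1, …, n}`. -/
def Idx (n : ℕ+) : Type := Fin n

instance (n : ℕ+) : Fintype (Idx n) := inferInstanceAs (Fintype (Fin n))

instance (n : ℕ+) : DecidableEq (Idx n) := inferInstanceAs (DecidableEq (Fin n))

instance : Unique (Idx 1) := inferInstanceAs (Unique (Fin 1))

instance (n : ℕ+) : Nonempty (Idx n) := ⟨(⟨0, n.pos⟩ : Fin n)⟩

/-- Matrices of positive size `m × n`. -/
abbrev Mat (m n : ℕ+) (X : Type*) := Matrix (Idx m) (Idx n) X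

/-- The index set of a block matrix. -/
def sumEquiv (m n : ℕ+) : Idx m ⊕ Idx n ≃ Idx (m + n) :=
  (finSumFinEquiv (m := m) (n := n)).trans (finCongr (PNat.add_coe m n).symm)

/-- The block matrix with rows `(a, b)` and `(c, d)`. -/
def blocks {X : Type*} {l n m s : ℕ+} (a : Mat l m X) (b : Mat l s X) (c : Mat n m X)
    (d : Mat n s X) : Mat (l + n) (m + s) X :=
  Matrix.reindex (sumEquiv l n) (sumEquiv m s) (Matrix.fromBlocks a b c d)

/-- The block diagonal matrix of two (rectangular) matrices. -/
def dsum {X : Type*} [Zero X] {l n m s : ℕ+} (x : Mat l m X) (y : Mat n s X) :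
    Mat (l + n) (m + s) X :=
  blocks x 0 0 y

/-- `x ⊕ ⋯ ⊕ x` with `n` summands, for `x : X`. For `n = 1` this identifies `X` with the
`1 × 1` matrices over `X`. -/
def amp {X : Type*} [Zero X] (n : ℕ+) (x : X) : Mat n n X := Matrix.diagonal fun _ => x

section Scalars

variable {X : Type*} [AddCommGroup X] [Module ℂ X]

/-- Left multiplication of a matrix over `X` by a scalar matrix. -/
def lmul {l m n : ℕ+} (a : Mat l m ℂ) (x : Mat m n X) : Mat l n X :=
  Matrix.of fun i j => ∑ k, a i k • x k j

/-- Right multiplication of a matrix over `X` by a scalar matrix. -/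
def rmul {l m n : ℕ+} (x : Mat l m X) (a : Mat m n ℂ) : Mat l n X :=
  Matrix.of fun i j => ∑ k, a k j • x i k

end Scalars

/-- A matrix ordered space: a complex `*`-vector space `X` with a convex cone of self-adjoint
matrices at every matrix level, compatible with `v ↦ a⋆ v a` for scalar matrices `a`. -/
structure MatrixOrderedSpace (X : Type*) [AddCommGroup X] [Module ℂ X] [StarAddMonoid X]
    [StarModule ℂ X] where
  pos : ∀ n : ℕ+, Set (Mat n n X)
  isHermitian_of_pos : ∀ {n : ℕ+} {v : Mat n n X}, v ∈ pos n → v.IsHermitian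
  zero_mem : ∀ n : ℕ+, (0 : Mat n n X) ∈ pos n
  add_mem : ∀ {n : ℕ+} {v w : Mat n n X}, v ∈ pos n → w ∈ pos n → v + w ∈ pos n
  smul_mem : ∀ {n : ℕ+} {v : Mat n n X} {k : ℝ}, 0 ≤ k → v ∈ pos n → (k : ℂ) • v ∈ pos n
  conj_mem : ∀ {n m : ℕ+} {v : Mat n n X} (a : Mat n m ℂ),
    v ∈ pos n → lmul aᴴ (rmul v a) ∈ pos m

/-- A matrix order unit space: `unit` is an order unit for the self-adjoint part of `X`, the cone
of `X` is proper and all the cones are Archimedean. -/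
structure MatrixOrderUnitSpace (X : Type*) [AddCommGroup X] [Module ℂ X] [StarAddMonoid X]
    [StarModule ℂ X] extends MatrixOrderedSpace X where
  unit : X
  unit_pos : amp 1 unit ∈ pos 1
  order_unit : ∀ y : X, IsSelfAdjoint y →
    ∃ ε : ℝ, 0 < ε ∧ amp 1 ((ε : ℂ) • unit + y) ∈ pos 1 ∧ amp 1 ((ε : ℂ) • unit - y) ∈ pos 1
  proper : ∀ y : X, amp 1 y ∈ pos 1 → amp 1 (-y) ∈ pos 1 → y = 0
  archimedean : ∀ {n : ℕ+} {u v : Mat n n X}, u ∈ pos n → v.IsHermitian →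
    (∀ k : ℝ, 0 < k → (k : ℂ) • u + v ∈ pos n) → v ∈ pos n

namespace MatrixOrderUnitSpace

variable {X : Type*} [AddCommGroup X] [Module ℂ X] [StarAddMonoid X] [StarModule ℂ X]

/-- The matrix norm determined by the order unit. -/
noncomputable def matNorm (S : MatrixOrderUnitSpace X) {n : ℕ+} (y : Mat n n X) : ℝ :=
  sInf {ε : ℝ | 0 < ε ∧
    blocks (amp n ((ε : ℂ) • S.unit)) y yᴴ (amp n ((ε : ℂ) • S.unit)) ∈ S.pos (n + n)}

/-- `u ⊥_∞ v`. -/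
def OrthInf (S : MatrixOrderUnitSpace X) {n : ℕ+} (u v : Mat n n X) : Prop :=
  ∀ α β : ℝ, S.matNorm ((α : ℂ) • u + (β : ℂ) • v) =
    max (S.matNorm ((α : ℂ) • u)) (S.matNorm ((β : ℂ) • v))

/-- `u ⊥_∞^a v`: `u₁ ⊥_∞ v₁` whenever `0 ≤ u₁ ≤ u` and `0 ≤ v₁ ≤ v`. -/
def AbsOrthInf (S : MatrixOrderUnitSpace X) {n : ℕ+} (u v : Mat n n X) : Prop :=
  ∀ u₁ v₁ : Mat n n X, u₁ ∈ S.pos n → u - u₁ ∈ S.pos n → v₁ ∈ S.pos n → v - v₁ ∈ S.pos n →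
    S.OrthInf u₁ v₁

end MatrixOrderUnitSpace

/-- An absolute matrix order unit space. The fields `abs_of_pos` to `orth_abs_sub` say that the
self-adjoint matrices of each size form an absolutely ordered space, where `u ⊥ v` means
`|u - v| = u + v`. The norm of a scalar matrix is its operator norm. -/
structure AbsMatrixOrderUnitSpace (X : Type*) [AddCommGroup X] [Module ℂ X] [StarAddMonoid X]
    [StarModule ℂ X] extends MatrixOrderUnitSpace X where
  abs : ∀ {l m : ℕ+}, Mat l m X → Mat m m X
  abs_mem : ∀ {l m : ℕ+} (x : Mat l m X), abs x ∈ pos m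
  abs_of_pos : ∀ {n : ℕ+} {v : Mat n n X}, v ∈ pos n → abs v = v
  abs_add_mem : ∀ {n : ℕ+} {v : Mat n n X}, v.IsHermitian → abs v + v ∈ pos n
  abs_sub_mem : ∀ {n : ℕ+} {v : Mat n n X}, v.IsHermitian → abs v - v ∈ pos n
  abs_smul : ∀ {n : ℕ+} {v : Mat n n X} (k : ℝ), v.IsHermitian →
    abs ((k : ℂ) • v) = ((|k| : ℝ) : ℂ) • abs v
  orth_of_le : ∀ {n : ℕ+} {u v w : Mat n n X}, u.IsHermitian → v.IsHermitian →
    w.IsHermitian → abs (u - v) = u + v → w ∈ pos n → v - w ∈ pos n → abs (u - w) = u + w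
  orth_abs_add : ∀ {n : ℕ+} {u v w : Mat n n X}, u.IsHermitian → v.IsHermitian →
    w.IsHermitian → abs (u - v) = u + v → abs (u - w) = u + w →
    abs (u - abs (v + w)) = u + abs (v + w)
  orth_abs_sub : ∀ {n : ℕ+} {u v w : Mat n n X}, u.IsHermitian → v.IsHermitian →
    w.IsHermitian → abs (u - v) = u + v → abs (u - w) = u + w →
    abs (u - abs (v - w)) = u + abs (v - w)
  abs_mul_le : ∀ {l m n s : ℕ+} (a : Mat l m ℂ) (x : Mat m n X) (b : Mat n s ℂ),
    (‖a‖ : ℂ) • abs (rmul (abs x) b) - abs (lmul a (rmul x b)) ∈ pos s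
  abs_dsum : ∀ {l m n s : ℕ+} (x : Mat m n X) (y : Mat l s X),
    abs (dsum x y) = dsum (abs x) (abs y)
  orth_iff : ∀ {n : ℕ+} {u v : Mat n n X}, u ∈ pos n → v ∈ pos n →
    (abs (u - v) = u + v ↔ toMatrixOrderUnitSpace.AbsOrthInf u v)

section Basic

@[simp] theorem blocks_inl_inl {X : Type*} {l n m s : ℕ+} (a : Mat l m X) (b : Mat l s X)
    (c : Mat n m X) (d : Mat n s X) (i : Idx l) (j : Idx m) :
    blocks a b c d (sumEquiv l n (.inl i)) (sumEquiv m s (.inl j)) = a i j := by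
  simp [blocks]

@[simp] theorem blocks_inl_inr {X : Type*} {l n m s : ℕ+} (a : Mat l m X) (b : Mat l s X)
    (c : Mat n m X) (d : Mat n s X) (i : Idx l) (j : Idx s) :
    blocks a b c d (sumEquiv l n (.inl i)) (sumEquiv m s (.inr j)) = b i j := by
  simp [blocks]

@[simp] theorem blocks_inr_inl {X : Type*} {l n m s : ℕ+} (a : Mat l m X) (b : Mat l s X)
    (c : Mat n m X) (d : Mat n s X) (i : Idx n) (j : Idx m) :
    blocks a b c d (sumEquiv l n (.inr i)) (sumEquiv m s (.inl j)) = c i j := by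
  simp [blocks]

@[simp] theorem blocks_inr_inr {X : Type*} {l n m s : ℕ+} (a : Mat l m X) (b : Mat l s X)
    (c : Mat n m X) (d : Mat n s X) (i : Idx n) (j : Idx s) :
    blocks a b c d (sumEquiv l n (.inr i)) (sumEquiv m s (.inr j)) = d i j := by
  simp [blocks]

theorem mat_ext {X : Type*} {l n m s : ℕ+} {A B : Mat (l + n) (m + s) X}
    (h : ∀ i j, A (sumEquiv l n i) (sumEquiv m s j) = B (sumEquiv l n i) (sumEquiv m s j)) :
    A = B := by
  ext i j
  obtain ⟨i, rfl⟩ := (sumEquiv l n).surjective i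
  obtain ⟨j, rfl⟩ := (sumEquiv m s).surjective j
  exact h i j

theorem blocks_conjTranspose {X : Type*} [Star X] {l n m s : ℕ+} (a : Mat l m X) (b : Mat l s X)
    (c : Mat n m X) (d : Mat n s X) : (blocks a b c d)ᴴ = blocks aᴴ cᴴ bᴴ dᴴ := by
  apply mat_ext
  rintro (i | i) (j | j) <;> simp [Matrix.conjTranspose_apply]

theorem dsum_conjTranspose {X : Type*} [AddCommGroup X] [StarAddMonoid X] {l n m s : ℕ+}
    (x : Mat l m X) (y : Mat n s X) : (dsum x y)ᴴ = dsum xᴴ yᴴ := by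
  simp [dsum, blocks_conjTranspose]

theorem amp_add {X : Type*} [AddCommGroup X] (m n : ℕ+) (x : X) : amp (m + n) x = dsum (amp m x) (amp n x) := by
  apply mat_ext
  rintro (i | i) (j | j) <;> simp [dsum, amp, Matrix.diagonal_apply]

variable {X : Type*} [AddCommGroup X] [Module ℂ X]

theorem lmul_one {m n : ℕ+} (x : Mat m n X) : lmul 1 x = x := by
  ext i j
  simp [lmul, Matrix.one_apply]

theorem rmul_one {m n : ℕ+} (x : Mat m n X) : rmul x 1 = x := by
  ext i j
  simp [rmul, Matrix.one_apply]

theorem lmul_lmul {k l m n : ℕ+} (a : Mat k l ℂ) (b : Mat l m ℂ) (x : Mat m n X) :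
    lmul a (lmul b x) = lmul (a * b) x := by
  ext i j
  simp only [lmul, Matrix.of_apply, Matrix.mul_apply, Finset.smul_sum, Finset.sum_smul, smul_smul]
  rw [Finset.sum_comm]

theorem lmul_rmul {k l m n : ℕ+} (a : Mat k l ℂ) (x : Mat l m X) (b : Mat m n ℂ) :
    rmul (lmul a x) b = lmul a (rmul x b) := by
  ext i j
  simp only [lmul, rmul, Matrix.of_apply, Finset.smul_sum]
  rw [Finset.sum_comm]
  simp only [smul_smul, mul_comm]

theorem lmul_conjTranspose [StarAddMonoid X] [StarModule ℂ X] {l m n : ℕ+} (a : Mat l m ℂ)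
    (x : Mat m n X) : (lmul a x)ᴴ = rmul xᴴ aᴴ := by
  ext i j
  simp [lmul, rmul, Matrix.conjTranspose_apply, star_sum, star_smul]

/-- The scalar matrix of a map of indices. -/
def rowMat {m n : ℕ+} (f : Idx n → Idx m) : Mat m n ℂ :=
  Matrix.of fun a k => if a = f k then 1 else 0

theorem rowMat_isometry {m n : ℕ+} {f : Idx n → Idx m} (hf : Function.Injective f) :
    (rowMat f)ᴴ * rowMat f = 1 := by
  ext i j
  simp [rowMat, Matrix.mul_apply, Matrix.conjTranspose_apply, Matrix.one_apply, hf.eq_iff,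
    eq_comm]

theorem norm_le_one_of_isometry {m n : ℕ+} {a : Mat m n ℂ} (ha : aᴴ * a = 1) : ‖a‖ ≤ 1 := by
  have h := Matrix.l2_opNorm_conjTranspose_mul_self a
  rw [ha, CStarRing.norm_one] at h
  nlinarith [norm_nonneg a]

end Basic

namespace MatrixOrderedSpace

variable {X : Type*} [AddCommGroup X] [Module ℂ X] [StarAddMonoid X] [StarModule ℂ X]
  (S : MatrixOrderedSpace X)

theorem sum_mem {ι : Type*} {n : ℕ+} (s : Finset ι) (f : ι → Mat n n X)
    (h : ∀ i ∈ s, f i ∈ S.pos n) : ∑ i ∈ s, f i ∈ S.pos n := by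
  classical
  induction s using Finset.induction_on with
  | empty => simpa using S.zero_mem n
  | insert a s ha ih =>
    rw [Finset.sum_insert ha]
    exact S.add_mem (h a (by simp)) (ih fun i hi => h i (by simp [hi]))

theorem sub_mem {m n : ℕ+} (f : Idx m → Idx n) (c : Idx m → ℂ) {v : Mat n n X}
    (hv : v ∈ S.pos n) :
    (Matrix.of fun i j => (star (c i) * c j) • v (f i) (f j)) ∈ S.pos m := by
  have h := S.conj_mem (Matrix.of fun k i => if k = f i then c i else 0) hv
  convert h using 1
  ext i j
  simp [lmul, rmul, Matrix.conjTranspose_apply, apply_ite, ite_smul, smul_smul]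

theorem amp_mem (n : ℕ+) {x : X} (hx : amp 1 x ∈ S.pos 1) : amp n x ∈ S.pos n := by
  have h := S.sum_mem Finset.univ (fun a : Idx n => _)
    (fun a _ => S.sub_mem (fun _ : Idx n => (default : Idx 1)) (fun i => if i = a then 1 else 0) hx)
  convert h using 1
  ext i j
  rw [Matrix.sum_apply]
  simp only [amp, Matrix.diagonal_apply, Matrix.of_apply]
  by_cases h : i = j
  · subst h
    simp [apply_ite star, ite_smul]
  · simp [h, apply_ite star, ite_smul]

theorem half_mem {n : ℕ+} {v w : Mat n n X} (h : v ∈ S.pos n) (hw : v = (2 : ℂ) • w) :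
    w ∈ S.pos n := by
  have := S.smul_mem (k := 1 / 2) (by norm_num) h
  rw [hw, smul_smul] at this
  simpa using this

theorem blocks_mem {n : ℕ+} {w y : Mat n n X} (hy : y.IsHermitian) (h₁ : w + y ∈ S.pos n)
    (h₂ : w - y ∈ S.pos n) : blocks w y yᴴ w ∈ S.pos (n + n) := by
  have e₁ := S.sub_mem (fun i => Sum.elim id id ((sumEquiv n n).symm i)) (fun _ => 1) h₁
  have e₂ := S.sub_mem (fun i => Sum.elim id id ((sumEquiv n n).symm i))
    (fun i => Sum.elim (fun _ => 1) (fun _ => -1) ((sumEquiv n n).symm i)) h₂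
  refine S.half_mem (S.add_mem e₁ e₂) ?_
  rw [hy.eq]
  apply mat_ext
  rintro (i | i) (j | j) <;> simp [two_smul] <;> abel

theorem of_blocks_mem {n : ℕ+} {w y : Mat n n X} (hy : y.IsHermitian)
    (h : blocks w y yᴴ w ∈ S.pos (n + n)) (c : ℝ) (hc : c = 1 ∨ c = -1) :
    w + (c : ℂ) • y ∈ S.pos n := by
  have e := S.conj_mem (Matrix.of fun k j => Sum.elim (fun i => if i = j then 1 else 0)
    (fun i => if i = j then (c : ℂ) else 0) ((sumEquiv n n).symm k)) h
  refine S.half_mem e ?_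
  rw [hy.eq]
  ext i j
  simp only [lmul, rmul, Matrix.of_apply, ← (sumEquiv n n).sum_comp, Fintype.sum_sum_type,
    Matrix.conjTranspose_apply]
  rcases hc with rfl | rfl <;> simp [apply_ite star, ite_smul, two_smul, Finset.sum_add_distrib] <;> abel

/-- `y` belongs to `X_x`: the matrix with rows `(ε x, y)` and `(y⋆, ε x)` is positive for some
`ε > 0`. -/
def Dom (x y : X) : Prop :=
  ∃ ε : ℝ, 0 < ε ∧
    blocks (amp 1 ((ε : ℂ) • x)) (amp 1 y) (amp 1 y)ᴴ (amp 1 ((ε : ℂ) • x)) ∈ S.pos (1 + 1)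

theorem amp_smul_mem (n : ℕ+) {x : X} (hx : amp 1 x ∈ S.pos 1) {k : ℝ} (hk : 0 ≤ k) :
    amp n ((k : ℂ) • x) ∈ S.pos n := by
  have h := S.smul_mem hk (S.amp_mem n hx)
  convert h using 1
  ext i j
  simp [amp, Matrix.diagonal_apply]

theorem dom_zero {x : X} (hx : amp 1 x ∈ S.pos 1) : S.Dom x 0 := by
  refine ⟨1, one_pos, ?_⟩
  convert S.amp_smul_mem (1 + 1) hx zero_le_one using 1
  rw [amp_add]
  simp [dsum, amp]

theorem dom_add {x y z : X} (hy : S.Dom x y) (hz : S.Dom x z) : S.Dom x (y + z) := by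
  obtain ⟨ε, hε, h⟩ := hy
  obtain ⟨δ, hδ, h'⟩ := hz
  refine ⟨ε + δ, by positivity, ?_⟩
  convert S.add_mem h h' using 1
  apply mat_ext
  rintro (i | i) (j | j) <;> simp [amp, Unique.eq_default, add_smul]

theorem dom_smul {x y : X} (hx : amp 1 x ∈ S.pos 1) (z : ℂ) (hy : S.Dom x y) :
    S.Dom x (z • y) := by
  obtain ⟨ε, hε, h⟩ := hy
  refine ⟨ε * (1 + ‖z‖ ^ 2), by positivity, ?_⟩
  have h₁ := S.sub_mem id
    (fun i => Sum.elim (fun _ => 1) (fun _ => z) ((sumEquiv 1 1).symm i)) h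
  have h₂ := S.sub_mem id
    (fun i => Sum.elim (fun _ => z) (fun _ => 0) ((sumEquiv 1 1).symm i))
    (S.amp_smul_mem (1 + 1) hx hε.le)
  have h₃ := S.sub_mem id
    (fun i => Sum.elim (fun _ => 0) (fun _ => 1) ((sumEquiv 1 1).symm i))
    (S.amp_smul_mem (1 + 1) hx hε.le)
  have hz : (starRingEnd ℂ) z * z = (‖z‖ : ℂ) ^ 2 := Complex.conj_mul' z
  convert S.add_mem h₁ (S.add_mem h₂ h₃) using 1
  apply mat_ext
  rintro (i | i) (j | j) <;>
    simp [amp, Matrix.diagonal_apply, Unique.eq_default, hz, smul_smul, ← add_smul,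
      -Complex.coe_smul] <;>
    ring_nf

theorem dom_star {x y : X} (hy : S.Dom x y) : S.Dom x (star y) := by
  obtain ⟨ε, hε, h⟩ := hy
  refine ⟨ε, hε, ?_⟩
  convert S.sub_mem (fun i => sumEquiv 1 1 ((sumEquiv 1 1).symm i).swap) (fun _ => 1) h using 1
  apply mat_ext
  rintro (i | i) (j | j) <;> simp [amp, Unique.eq_default]

theorem dom_self {x : X} (hx : amp 1 x ∈ S.pos 1) : S.Dom x x := by
  refine ⟨1, one_pos, ?_⟩
  apply S.blocks_mem (S.isHermitian_of_pos hx)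
  · simpa using S.add_mem hx hx
  · simpa using S.zero_mem 1

theorem dom_mono {x y : X} (hx : amp 1 x ∈ S.pos 1) {ε δ : ℝ} (hle : ε ≤ δ)
    (h : blocks (amp 1 ((ε : ℂ) • x)) (amp 1 y) (amp 1 y)ᴴ (amp 1 ((ε : ℂ) • x)) ∈ S.pos (1 + 1)) :
    blocks (amp 1 ((δ : ℂ) • x)) (amp 1 y) (amp 1 y)ᴴ (amp 1 ((δ : ℂ) • x)) ∈ S.pos (1 + 1) := by
  convert S.add_mem h (S.amp_smul_mem (1 + 1) hx (sub_nonneg.2 hle)) using 1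
  rw [amp_add]
  apply mat_ext
  rintro (i | i) (j | j) <;>
    simp [amp, dsum, Unique.eq_default, ← add_smul, -Complex.coe_smul]

theorem exists_of_dom {x : X} (hx : amp 1 x ∈ S.pos 1) {n : ℕ+} {y : Mat n n X}
    (hy : y.IsHermitian) (h : ∀ i j, S.Dom x (y i j)) :
    ∃ ε : ℝ, 0 < ε ∧ amp n ((ε : ℂ) • x) + y ∈ S.pos n ∧ amp n ((ε : ℂ) • x) - y ∈ S.pos n := by
  choose ε hε hp using h
  let δ : ℝ := ∑ i, ∑ j, ε i j
  have hle : ∀ i j, ε i j ≤ δ := fun i j =>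
    (Finset.single_le_sum (f := fun j => ε i j) (fun j _ => (hε i j).le) (Finset.mem_univ j)).trans
      (Finset.single_le_sum (f := fun i => ∑ j, ε i j)
        (fun i _ => Finset.sum_nonneg fun j _ => (hε i j).le) (Finset.mem_univ i))
  have hδ : 0 < δ := (hε (Classical.arbitrary _) (Classical.arbitrary _)).trans_le (hle _ _)
  have key : ∀ c : ℝ, c = 1 ∨ c = -1 →
      amp n ((((n : ℕ) * δ : ℝ) : ℂ) • x) + (c : ℂ) • y ∈ S.pos n := by
    intro c hc
    have e := S.sum_mem Finset.univ (fun p : Idx n × Idx n => _) (fun p _ =>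
      S.conj_mem (Matrix.of fun k b => Sum.elim (fun _ => if b = p.1 then 1 else 0)
        (fun _ => if b = p.2 then (c : ℂ) else 0) ((sumEquiv 1 1).symm k))
        (S.dom_mono hx (hle p.1 p.2) (hp p.1 p.2)))
    refine S.half_mem e ?_
    have hcard : Fintype.card (Idx n) = n := Fintype.card_fin n
    ext a b
    have hab : star (y b a) = y a b := by
      conv_rhs => rw [← hy.eq]
      rfl
    rw [Matrix.sum_apply, Fintype.sum_prod_type]
    simp only [lmul, rmul, Matrix.of_apply, ← (sumEquiv 1 1).sum_comp, Fintype.sum_sum_type,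
      Matrix.conjTranspose_apply]
    rcases eq_or_ne a b with rfl | hne <;> rcases hc with rfl | rfl <;>
      simp [apply_ite star, ite_smul, Unique.eq_default, amp, Finset.sum_add_distrib,
        mul_smul, ← Nat.cast_smul_eq_nsmul ℂ, *, -Complex.coe_smul] <;> module
  refine ⟨(n : ℕ) * δ, by have := n.pos; positivity, ?_, ?_⟩
  · simpa using key 1 (Or.inl rfl)
  · simpa [sub_eq_add_neg] using key (-1) (Or.inr rfl)

theorem dom_of_le {x : X} {n : ℕ+} {y : Mat n n X} (hy : y.IsHermitian) {ε : ℝ} (hε : 0 < ε)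
    (h₁ : amp n ((ε : ℂ) • x) + y ∈ S.pos n) (h₂ : amp n ((ε : ℂ) • x) - y ∈ S.pos n)
    (i j : Idx n) : S.Dom x (y i j) := by
  refine ⟨ε, hε, ?_⟩
  have e₁ := S.sub_mem (fun k => Sum.elim (fun _ => i) (fun _ => j) ((sumEquiv 1 1).symm k))
    (fun _ => 1) h₁
  have e₂ := S.sub_mem (fun k => Sum.elim (fun _ => i) (fun _ => j) ((sumEquiv 1 1).symm k))
    (fun k => Sum.elim (fun _ => 1) (fun _ => -1) ((sumEquiv 1 1).symm k)) h₂
  refine S.half_mem (S.add_mem e₁ e₂) ?_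
  have hij : star (y i j) = y j i := by
    conv_rhs => rw [← hy.eq]
    rfl
  apply mat_ext
  rintro (a | a) (b | b) <;>
    simp [amp, Matrix.diagonal_apply, Unique.eq_default, two_smul, hij, eq_comm] <;> abel

end MatrixOrderedSpace

namespace AbsMatrixOrderUnitSpace

variable {X : Type*} [AddCommGroup X] [Module ℂ X] [StarAddMonoid X] [StarModule ℂ X]
  (S : AbsMatrixOrderUnitSpace X)

/-- `p` is an order projection: `p` is self-adjoint and `|2p - eⁿ| = eⁿ`. -/
def IsOrderProj {n : ℕ+} (p : Mat n n X) : Prop :=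
  p.IsHermitian ∧ S.abs ((2 : ℂ) • p - amp n S.unit) = amp n S.unit

/-- `v` is a partial isometry: `|v|` and `|v⋆|` are order projections. -/
def IsPartialIso {m n : ℕ+} (v : Mat m n X) : Prop :=
  S.IsOrderProj (S.abs v) ∧ S.IsOrderProj (S.abs vᴴ)

/-- Condition (T). -/
def CondT : Prop :=
  ∀ (l m n : ℕ+) (u : Mat m n X) (v : Mat l n X), S.IsPartialIso u → S.IsPartialIso v →
    S.abs u = S.abs v →
    ∃ w : Mat m l X, S.IsPartialIso w ∧ S.abs wᴴ = S.abs uᴴ ∧ S.abs w = S.abs vᴴ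

/-- The set of order projections of all sizes. -/
structure OPInf where
  size : ℕ+
  mat : Mat size size X
  isOrderProj : S.IsOrderProj mat

variable {S} in
/-- Partial isometric equivalence `p ∼ q` of order projections. -/
def PIEquiv (p q : S.OPInf) : Prop :=
  ∃ v : Mat p.size q.size X, p.mat = S.abs vᴴ ∧ q.mat = S.abs v

theorem antisymm {n : ℕ+} {v w : Mat n n X} (h₁ : v - w ∈ S.pos n) (h₂ : w - v ∈ S.pos n) :
    v = w := by
  have h := S.abs_smul (-1) (S.isHermitian_of_pos h₁)
  have e : (((-1 : ℝ) : ℂ)) • (v - w) = w - v := by simp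
  rw [e, S.abs_of_pos h₁, S.abs_of_pos h₂] at h
  have h' : (2 : ℂ) • (v - w) = 0 := by
    simp only [abs_neg, abs_one, Complex.ofReal_one, one_smul] at h
    rw [two_smul]
    nth_rewrite 1 [← h]
    abel
  exact sub_eq_zero.1 ((smul_eq_zero.1 h').resolve_left two_ne_zero)

theorem abs_lmul_sub_mem {m n s : ℕ+} {a : Mat m n ℂ} (ha : ‖a‖ ≤ 1) (x : Mat n s X) :
    S.abs x - S.abs (lmul a x) ∈ S.pos s := by
  have h := S.abs_mul_le a x (1 : Mat s s ℂ)
  rw [rmul_one, rmul_one, S.abs_of_pos (S.abs_mem x)] at h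
  have h' := S.smul_mem (sub_nonneg.2 ha) (S.abs_mem x)
  convert S.add_mem h h' using 1
  push_cast
  module

theorem abs_lmul_isometry {m n s : ℕ+} {a : Mat m n ℂ} (ha : aᴴ * a = 1) (x : Mat n s X) :
    S.abs (lmul a x) = S.abs x := by
  have hn := norm_le_one_of_isometry ha
  refine S.antisymm ?_ (S.abs_lmul_sub_mem hn x)
  have h := S.abs_lmul_sub_mem (a := aᴴ) (by rwa [Matrix.l2_opNorm_conjTranspose]) (lmul a x)
  rwa [lmul_lmul, ha, lmul_one] at h

theorem IsOrderProj.mem {n : ℕ+} {p : Mat n n X} (hp : S.IsOrderProj p) : p ∈ S.pos n := by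
  have hu := S.amp_mem n S.unit_pos
  have h2 : ((2 : ℂ) • p).IsHermitian := by
    rw [Matrix.IsHermitian, Matrix.conjTranspose_smul, hp.1.eq]
    simp
  have h := S.abs_add_mem (h2.sub (S.isHermitian_of_pos hu))
  rw [hp.2] at h
  exact S.half_mem h (by abel)

theorem IsOrderProj.dsum {m n : ℕ+} {p : Mat m m X} {q : Mat n n X} (hp : S.IsOrderProj p)
    (hq : S.IsOrderProj q) : S.IsOrderProj (dsum p q) := by
  refine ⟨?_, ?_⟩
  · rw [Matrix.IsHermitian, dsum_conjTranspose, hp.1.eq, hq.1.eq]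
  · have : (2 : ℂ) • AMOU.dsum p q - amp (m + n) S.unit =
        AMOU.dsum ((2 : ℂ) • p - amp m S.unit) ((2 : ℂ) • q - amp n S.unit) := by
      rw [amp_add]
      apply mat_ext
      rintro (i | i) (j | j) <;> simp [AMOU.dsum]
    rw [this, S.abs_dsum, hp.2, hq.2, amp_add]

theorem isOrderProj_zero (n : ℕ+) : S.IsOrderProj (0 : Mat n n X) := by
  refine ⟨Matrix.isHermitian_zero, ?_⟩
  have hu := S.amp_mem n S.unit_pos
  have h := S.abs_smul (-1) (S.isHermitian_of_pos hu)
  simpa [S.abs_of_pos hu] using h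

variable {S}

/-- The sum `p ⊕ q` of order projections. -/
def OPInf.sum (p q : S.OPInf) : S.OPInf where
  size := p.size + q.size
  mat := dsum p.mat q.mat
  isOrderProj := IsOrderProj.dsum S p.isOrderProj q.isOrderProj

/-- `p ≈ q`: there is an order projection `r` with `p ⊕ r ∼ q ⊕ r`. -/
def StableEquiv (p q : S.OPInf) : Prop :=
  ∃ r : S.OPInf, PIEquiv (p.sum r) (q.sum r)

/-- The zero projection of size `1`. -/
def OPInf.zero (S : AbsMatrixOrderUnitSpace X) : S.OPInf where
  size := 1
  mat := 0
  isOrderProj := S.isOrderProj_zero 1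

theorem PIEquiv.refl (p : S.OPInf) : PIEquiv p p := by
  have h := S.abs_of_pos (IsOrderProj.mem S p.isOrderProj)
  exact ⟨p.mat, by rw [p.isOrderProj.1.eq, h], h.symm⟩

theorem PIEquiv.symm {p q : S.OPInf} (h : PIEquiv p q) : PIEquiv q p := by
  obtain ⟨v, h₁, h₂⟩ := h
  exact ⟨vᴴ, by rw [Matrix.conjTranspose_conjTranspose, h₂], h₁⟩

theorem PIEquiv.trans (hT : S.CondT) {p q r : S.OPInf} (h : PIEquiv p q) (h' : PIEquiv q r) :
    PIEquiv p r := by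
  obtain ⟨v, h₁, h₂⟩ := h
  obtain ⟨w, h₃, h₄⟩ := h'
  obtain ⟨z, -, hz₁, hz₂⟩ := hT _ _ _ v wᴴ ⟨h₂ ▸ q.isOrderProj, h₁ ▸ p.isOrderProj⟩
    ⟨h₃ ▸ q.isOrderProj, by rw [Matrix.conjTranspose_conjTranspose]; exact h₄ ▸ r.isOrderProj⟩
    (h₂.symm.trans h₃)
  rw [Matrix.conjTranspose_conjTranspose] at hz₂
  exact ⟨z, h₁.trans hz₁.symm, h₄.trans hz₂.symm⟩

theorem PIEquiv.sum {p q r s : S.OPInf} (h : PIEquiv p q) (h' : PIEquiv r s) :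
    PIEquiv (p.sum r) (q.sum s) := by
  obtain ⟨v, h₁, h₂⟩ := h
  obtain ⟨w, h₃, h₄⟩ := h'
  have e₁ : dsum p.mat r.mat = S.abs (dsum v w)ᴴ := by
    rw [dsum_conjTranspose, S.abs_dsum, ← h₁, ← h₃]
  have e₂ : dsum q.mat s.mat = S.abs (dsum v w) := by
    rw [S.abs_dsum, ← h₂, ← h₄]
  exact ⟨dsum v w, e₁, e₂⟩

/-- A projection is equivalent to its copies along injective maps of indices. -/
theorem PIEquiv.of_injective {p q : S.OPInf} (f : Idx p.size → Idx q.size)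
    (hf : Function.Injective f) (h₁ : ∀ i j, q.mat (f i) (f j) = p.mat i j)
    (h₂ : ∀ a, (∀ i, f i ≠ a) → ∀ b, q.mat a b = 0) : PIEquiv q p := by
  have hp := IsOrderProj.mem S p.isOrderProj
  have hq := IsOrderProj.mem S q.isOrderProj
  have hi := rowMat_isometry hf
  have e : q.mat = lmul (rowMat f) (rmul p.mat (rowMat f)ᴴ) := by
    have h₃ : ∀ a, (∀ i, f i ≠ a) → ∀ b, q.mat b a = 0 := fun a ha b => by
      rw [← q.isOrderProj.1.eq, Matrix.conjTranspose_apply, h₂ a ha, star_zero]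
    ext a b
    simp only [lmul, rmul, rowMat, Matrix.of_apply, Matrix.conjTranspose_apply]
    by_cases ha : ∃ i, f i = a
    · obtain ⟨i, rfl⟩ := ha
      by_cases hb : ∃ j, f j = b
      · obtain ⟨j, rfl⟩ := hb
        simp [h₁, hf.eq_iff, apply_ite star]
      · have hb' : ∀ j, ¬ b = f j := fun j hj => hb ⟨j, hj.symm⟩
        simp [hb', h₃ b fun j hj => hb ⟨j, hj⟩]
    · have ha' : ∀ j, ¬ a = f j := fun j hj => ha ⟨j, hj.symm⟩
      simp [ha', h₂ a fun j hj => ha ⟨j, hj⟩]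
  refine ⟨lmul (rowMat f) p.mat, ?_, ?_⟩
  · rw [lmul_conjTranspose, p.isOrderProj.1.eq, ← S.abs_lmul_isometry hi, ← e, S.abs_of_pos hq]
  · rw [S.abs_lmul_isometry hi, S.abs_of_pos hp]

theorem PIEquiv.sum_comm (p q : S.OPInf) : PIEquiv (p.sum q) (q.sum p) := by
  let f : Idx (q.size + p.size) ≃ Idx (p.size + q.size) :=
    (sumEquiv _ _).symm.trans <| (Equiv.sumComm _ _).trans (sumEquiv _ _)
  refine PIEquiv.of_injective f f.injective ?_ ?_
  · intro i j
    obtain ⟨i, rfl⟩ := (sumEquiv q.size p.size).surjective i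
    obtain ⟨j, rfl⟩ := (sumEquiv q.size p.size).surjective j
    rcases i with i | i <;> rcases j with j | j <;> simp [f, OPInf.sum, dsum]
  · intro a ha
    exact absurd (f.apply_symm_apply a) (ha _)

theorem PIEquiv.sum_zero (p : S.OPInf) : PIEquiv (p.sum (OPInf.zero S)) p := by
  refine PIEquiv.of_injective (fun i => sumEquiv p.size 1 (.inl i)) ?_ ?_ ?_
  · exact (sumEquiv p.size 1).injective.comp Sum.inl_injective
  · intro i j
    exact blocks_inl_inl _ _ _ _ _ _
  · intro a ha b
    obtain ⟨a, rfl⟩ := (sumEquiv p.size 1).surjective a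
    obtain ⟨b, rfl⟩ := (sumEquiv p.size 1).surjective b
    rcases a with a | a
    · exact absurd rfl (ha a)
    · rcases b with b | b
      · exact blocks_inr_inl _ _ _ _ _ _
      · exact blocks_inr_inr _ _ _ _ _ _

theorem PIEquiv.sum_assoc (p q r : S.OPInf) :
    PIEquiv ((p.sum q).sum r) (p.sum (q.sum r)) := by
  let f : Idx (p.size + (q.size + r.size)) ≃ Idx (p.size + q.size + r.size) :=
    (sumEquiv _ _).symm.trans <| (Equiv.sumCongr (Equiv.refl _) (sumEquiv _ _).symm).trans <|
      (Equiv.sumAssoc _ _ _).symm.trans <|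
      (Equiv.sumCongr (sumEquiv _ _) (Equiv.refl _)).trans (sumEquiv _ _)
  refine PIEquiv.of_injective f f.injective ?_ ?_
  · intro i j
    obtain ⟨i, rfl⟩ := (sumEquiv p.size (q.size + r.size)).surjective i
    obtain ⟨j, rfl⟩ := (sumEquiv p.size (q.size + r.size)).surjective j
    rcases i with i | i
    · rcases j with j | j
      · simp [f, OPInf.sum, dsum]
      · obtain ⟨j, rfl⟩ := (sumEquiv q.size r.size).surjective j
        rcases j with j | j <;> simp [f, OPInf.sum, dsum]
    · obtain ⟨i, rfl⟩ := (sumEquiv q.size r.size).surjective i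
      rcases j with j | j
      · rcases i with i | i <;> simp [f, OPInf.sum, dsum]
      · obtain ⟨j, rfl⟩ := (sumEquiv q.size r.size).surjective j
        rcases i with i | i <;> rcases j with j | j <;> simp [f, OPInf.sum, dsum]
  · intro a ha
    exact absurd (f.apply_symm_apply a) (ha _)

/-- Under (T), `∼` is an equivalence relation. -/
def piSetoid (hT : S.CondT) : Setoid S.OPInf where
  r := PIEquiv
  iseqv := ⟨PIEquiv.refl, PIEquiv.symm, PIEquiv.trans hT⟩

/-- The set of classes of order projections for `∼`. -/
def OPClass (hT : S.CondT) : Type _ := Quotient (piSetoid hT)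

/-- The class of an order projection. -/
def OPClass.mk (hT : S.CondT) (p : S.OPInf) : OPClass hT := Quotient.mk (piSetoid hT) p

instance (hT : S.CondT) : Add (OPClass hT) :=
  ⟨Quotient.map₂ OPInf.sum fun _ _ h _ _ h' => PIEquiv.sum h h'⟩

instance (hT : S.CondT) : Zero (OPClass hT) := ⟨OPClass.mk hT (OPInf.zero S)⟩

/-- Classes of order projections form a commutative monoid under `⊕`. -/
instance (hT : S.CondT) : AddCommMonoid (OPClass hT) where
  add_assoc := by
    rintro ⟨p⟩ ⟨q⟩ ⟨r⟩
    exact Quotient.sound (PIEquiv.sum_assoc p q r)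
  add_comm := by
    rintro ⟨p⟩ ⟨q⟩
    exact Quotient.sound (PIEquiv.sum_comm p q)
  zero_add := by
    rintro ⟨p⟩
    exact Quotient.sound
      (PIEquiv.trans hT (PIEquiv.sum_comm (OPInf.zero S) p) (PIEquiv.sum_zero p))
  add_zero := by
    rintro ⟨p⟩
    exact Quotient.sound (PIEquiv.sum_zero p)
  nsmul := nsmulRec

/-- The group `K₀`: the Grothendieck group of the monoid of classes of order projections. -/
abbrev K0 (hT : S.CondT) : Type _ := Algebra.GrothendieckAddGroup (OPClass hT)

/-- The element `[(p, q)]` of `K₀`. -/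
def K0.mk (hT : S.CondT) (p q : S.OPInf) : K0 hT :=
  AddLocalization.mk (OPClass.mk hT p) ⟨OPClass.mk hT q, AddSubmonoid.mem_top _⟩

/-- `K₀` consists of pairs of order projections modulo `(p, q) ≡ (r, s) ↔ p ⊕ s ≈ r ⊕ q`. -/
theorem K0.mk_eq_mk_iff (hT : S.CondT) (p q r s : S.OPInf) :
    K0.mk hT p q = K0.mk hT r s ↔ StableEquiv (p.sum s) (r.sum q) := by
  unfold K0.mk
  rw [AddLocalization.mk_eq_mk_iff, AddLocalization.r_iff_exists]
  constructor
  · rintro ⟨⟨⟨c⟩, hc⟩, h⟩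
    have h' : OPClass.mk hT p + OPClass.mk hT s + OPClass.mk hT c =
        OPClass.mk hT r + OPClass.mk hT q + OPClass.mk hT c := by
      rw [add_comm (OPClass.mk hT p), add_comm (OPClass.mk hT r), add_comm _ (OPClass.mk hT c),
        add_comm _ (OPClass.mk hT c)]
      exact h
    exact ⟨c, Quotient.exact h'⟩
  · rintro ⟨c, h⟩
    have h' : OPClass.mk hT p + OPClass.mk hT s + OPClass.mk hT c =
        OPClass.mk hT r + OPClass.mk hT q + OPClass.mk hT c := Quotient.sound h
    refine ⟨⟨OPClass.mk hT c, AddSubmonoid.mem_top _⟩, ?_⟩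
    rw [add_comm (OPClass.mk hT p), add_comm (OPClass.mk hT r), add_comm _ (OPClass.mk hT c),
      add_comm _ (OPClass.mk hT c)] at h'
    exact h'

/-- `x` has the absolute matrix order unit property: `x ≥ 0` and, for all `n`,
`|y| ≤ ‖y‖ xⁿ` for every self-adjoint `y` with `± y ≤ ε xⁿ` for some `ε > 0`. -/
def HasAbsMatrixOrderUnitProperty (S : AbsMatrixOrderUnitSpace X) (x : X) : Prop :=
  amp 1 x ∈ S.pos 1 ∧ ∀ (n : ℕ+) (y : Mat n n X), y.IsHermitian →
    (∃ ε : ℝ, 0 < ε ∧ amp n ((ε : ℂ) • x) + y ∈ S.pos n ∧ amp n ((ε : ℂ) • x) - y ∈ S.pos n) →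
    amp n ((S.matNorm y : ℂ) • x) - S.abs y ∈ S.pos n

end AbsMatrixOrderUnitSpace

section Ideal

variable {X : Type*} [AddCommGroup X] [Module ℂ X] [StarAddMonoid X] [StarModule ℂ X]

/-- The subspace `X_x` of `X`, for `x ≥ 0`. -/
def MatrixOrderedSpace.sub (S : MatrixOrderedSpace X) (x : X) (hx : amp 1 x ∈ S.pos 1) :
    Submodule ℂ X where
  carrier := {y | S.Dom x y}
  add_mem' := S.dom_add
  zero_mem' := S.dom_zero hx
  smul_mem' z _ hy := S.dom_smul hx z hy

variable {S : MatrixOrderedSpace X} {x : X} {hx : amp 1 x ∈ S.pos 1}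

instance : StarAddMonoid (S.sub x hx) where
  star y := ⟨star (y : X), S.dom_star y.2⟩
  star_involutive y := Subtype.ext (star_star (y : X))
  star_add y z := Subtype.ext (star_add (y : X) z)

instance : StarModule ℂ (S.sub x hx) where
  star_smul z y := Subtype.ext (star_smul z (y : X))

/-- A matrix over `X_x` as a matrix over `X`. -/
def emb {m n : ℕ+} (y : Mat m n (S.sub x hx)) : Mat m n X := y.map Subtype.val

section

variable {k l m n : ℕ+}

theorem emb_injective : Function.Injective (emb : Mat m n (S.sub x hx) → Mat m n X) :=
  Matrix.map_injective Subtype.val_injective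

theorem emb_add (y z : Mat m n (S.sub x hx)) : emb (y + z) = emb y + emb z := rfl

theorem emb_sub (y z : Mat m n (S.sub x hx)) : emb (y - z) = emb y - emb z := rfl

theorem emb_smul (c : ℂ) (y : Mat m n (S.sub x hx)) : emb (c • y) = c • emb y := rfl

theorem emb_zero : emb (0 : Mat m n (S.sub x hx)) = 0 := rfl

theorem emb_conjTranspose (y : Mat m n (S.sub x hx)) : emb yᴴ = (emb y)ᴴ := rfl

theorem emb_lmul (a : Mat l m ℂ) (y : Mat m n (S.sub x hx)) : emb (lmul a y) = lmul a (emb y) := by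
  ext i j
  simp [emb, lmul]

theorem emb_rmul (y : Mat m n (S.sub x hx)) (a : Mat n l ℂ) : emb (rmul y a) = rmul (emb y) a := by
  ext i j
  simp [emb, rmul]

theorem emb_blocks (a : Mat k m (S.sub x hx)) (b : Mat k n (S.sub x hx))
    (c : Mat l m (S.sub x hx)) (d : Mat l n (S.sub x hx)) :
    emb (blocks a b c d) = blocks (emb a) (emb b) (emb c) (emb d) := by
  apply mat_ext
  rintro (i | i) (j | j) <;> simp [emb]

theorem emb_dsum (a : Mat k m (S.sub x hx)) (d : Mat l n (S.sub x hx)) :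
    emb (dsum a d) = dsum (emb a) (emb d) :=
  emb_blocks a 0 0 d

theorem emb_amp (y : S.sub x hx) : emb (amp n y) = amp n (y : X) := by
  ext i j
  by_cases h : i = j <;> simp [emb, amp, h]

theorem emb_isHermitian {y : Mat n n (S.sub x hx)} : (emb y).IsHermitian ↔ y.IsHermitian :=
  ⟨fun h => emb_injective h.eq, fun h => congrArg emb h.eq⟩

theorem exists_emb {y : Mat m n X} (h : ∀ i j, S.Dom x (y i j)) :
    ∃ z : Mat m n (S.sub x hx), emb z = y :=
  ⟨Matrix.of fun i j => ⟨y i j, h i j⟩, rfl⟩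

end

/-- `X_x` as a matrix ordered space. -/
def MatrixOrderedSpace.ideal (S : MatrixOrderedSpace X) (x : X) (hx : amp 1 x ∈ S.pos 1) :
    MatrixOrderedSpace (S.sub x hx) where
  pos n := {y | emb y ∈ S.pos n}
  isHermitian_of_pos h := emb_isHermitian.1 (S.isHermitian_of_pos h)
  zero_mem n := S.zero_mem n
  add_mem h h' := S.add_mem h h'
  smul_mem hk h := S.smul_mem hk h
  conj_mem a h := by
    change emb (lmul aᴴ (rmul _ a)) ∈ S.pos _
    rw [emb_lmul, emb_rmul]
    exact S.conj_mem a h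

/-- `X_x` as a matrix order unit space with order unit `x`. -/
def MatrixOrderUnitSpace.ideal (S : MatrixOrderUnitSpace X) (x : X) (hx : amp 1 x ∈ S.pos 1) :
    MatrixOrderUnitSpace (S.toMatrixOrderedSpace.sub x hx) where
  toMatrixOrderedSpace := S.toMatrixOrderedSpace.ideal x hx
  unit := ⟨x, S.dom_self hx⟩
  unit_pos := by
    simpa [MatrixOrderedSpace.ideal, emb_amp] using hx
  order_unit y hy := by
    have hy' : (amp 1 (y : X)).IsHermitian := by
      have h : star (y : X) = y := congrArg Subtype.val hy.star_eq
      simp [Matrix.IsHermitian, amp, Matrix.diagonal_conjTranspose, Pi.star_def, h]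
    obtain ⟨ε, hε, h₁, h₂⟩ := S.exists_of_dom hx hy' (fun i j => by
      have h : S.Dom x (y : X) := y.2
      simpa [amp, Unique.eq_default] using h)
    refine ⟨ε, hε, ?_, ?_⟩
    · change emb _ ∈ S.pos 1
      rw [emb_amp]
      convert h₁ using 1
      simp [amp]
    · change emb _ ∈ S.pos 1
      rw [emb_amp]
      convert h₂ using 1
      simp [amp]
  proper y h₁ h₂ := by
    change emb _ ∈ S.pos 1 at h₁ h₂
    rw [emb_amp] at h₁ h₂
    exact Subtype.ext (S.proper y h₁ h₂)
  archimedean hu hv h := S.archimedean hu (emb_isHermitian.2 hv) h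

end Ideal

namespace AbsMatrixOrderUnitSpace

variable {X : Type*} [AddCommGroup X] [Module ℂ X] [StarAddMonoid X] [StarModule ℂ X]
  (S : AbsMatrixOrderUnitSpace X)

theorem abs_blocks {l m : ℕ+} (y : Mat l m X) :
    S.abs (blocks 0 y yᴴ 0) = dsum (S.abs yᴴ) (S.abs y) := by
  rw [← S.abs_dsum]
  let f : Idx (m + l) ≃ Idx (l + m) :=
    (sumEquiv _ _).symm.trans <| (Equiv.sumComm _ _).trans (sumEquiv _ _)
  rw [← S.abs_lmul_isometry (rowMat_isometry f.injective)]
  congr 1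
  apply mat_ext
  rintro (i | i) (j | j) <;>
    simp [lmul, rowMat, f, ← (sumEquiv m l).sum_comp, dsum, ite_smul]

variable {S} in
theorem HasAbsMatrixOrderUnitProperty.abs_dom {x : X} (hx : S.HasAbsMatrixOrderUnitProperty x)
    {l m : ℕ+} {y : Mat l m X} (hy : ∀ i j, S.Dom x (y i j)) (i j : Idx m) :
    S.Dom x (S.abs y i j) := by
  have hz : (blocks 0 y yᴴ 0).IsHermitian := by
    simp [Matrix.IsHermitian, blocks_conjTranspose]
  have hd : ∀ i j, S.Dom x (blocks 0 y yᴴ 0 i j) := by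
    intro i j
    obtain ⟨i, rfl⟩ := (sumEquiv l m).surjective i
    obtain ⟨j, rfl⟩ := (sumEquiv l m).surjective j
    rcases i with i | i <;> rcases j with j | j <;>
      simp [S.dom_zero hx.1, hy, S.dom_star]
  have h := hx.2 _ _ hz (S.exists_of_dom hx.1 hz hd)
  rw [S.abs_blocks] at h
  set c := S.matNorm (blocks 0 y yᴴ 0)
  have hc : 0 ≤ c := Real.sInf_nonneg fun ε hε => hε.1.le
  have h' := S.sub_mem (fun k : Idx m => sumEquiv l m (.inr k)) (fun _ => 1) h
  have e : amp m ((c : ℂ) • x) - S.abs y ∈ S.pos m := by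
    convert h' using 1
    ext a b
    simp [amp_add, dsum]
  have hm := S.abs_mem y
  have hxm := S.amp_mem m hx.1
  have e₁ : amp m (((c + 1 : ℝ) : ℂ) • x) = amp m ((c : ℂ) • x) + amp m x := by
    ext a b
    by_cases h : a = b <;> simp [amp, h, add_smul]
  refine S.dom_of_le (S.isHermitian_of_pos hm) (ε := c + 1) (by positivity) ?_ ?_ i j
  · exact S.add_mem (S.amp_smul_mem m hx.1 (by positivity)) hm
  · rw [e₁]
    convert S.add_mem e hxm using 1
    abel

theorem dom_of_pos_le {x : X} (hx : amp 1 x ∈ S.pos 1) {n : ℕ+} {u v : Mat n n X}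
    (hu : u ∈ S.pos n) (h : v - u ∈ S.pos n) (hv : ∀ i j, S.Dom x (v i j)) (i j : Idx n) :
    S.Dom x (u i j) := by
  have hvp : v ∈ S.pos n := by simpa using S.add_mem h hu
  obtain ⟨ε, hε, -, h₂⟩ := S.exists_of_dom hx (S.isHermitian_of_pos hvp) hv
  refine S.dom_of_le (S.isHermitian_of_pos hu) hε ?_ ?_ i j
  · exact S.add_mem (S.amp_smul_mem n hx hε.le) hu
  · simpa using S.add_mem h₂ h

theorem unit_sub_mem {x : X} (hx : amp 1 x ∈ S.pos 1) (h1 : S.matNorm (amp 1 x) = 1) :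
    amp 1 (S.unit - x) ∈ S.pos 1 := by
  have hxh := S.isHermitian_of_pos hx
  have hu := S.isHermitian_of_pos S.unit_pos
  have e : ∀ y z : X, amp 1 (y - z) = amp 1 y - amp 1 z := fun y z => by simp [amp]
  rw [e]
  refine S.archimedean S.unit_pos (hu.sub hxh) fun k hk => ?_
  have hne : {ε : ℝ | 0 < ε ∧ blocks (amp 1 ((ε : ℂ) • S.unit)) (amp 1 x) (amp 1 x)ᴴ
      (amp 1 ((ε : ℂ) • S.unit)) ∈ S.pos (1 + 1)}.Nonempty := by
    by_contra h
    rw [Set.not_nonempty_iff_eq_empty] at h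
    rw [MatrixOrderUnitSpace.matNorm, h, Real.sInf_empty] at h1
    exact zero_ne_one h1
  obtain ⟨ε, ⟨hε, hb⟩, hlt⟩ := exists_lt_of_csInf_lt hne
    (show S.matNorm (amp 1 x) < 1 + k by linarith)
  have h := S.of_blocks_mem hxh hb (-1) (Or.inr rfl)
  convert S.add_mem h (S.amp_smul_mem 1 S.unit_pos (sub_nonneg.2 hlt.le)) using 1
  ext a b
  simp [amp, Unique.eq_default, -Complex.coe_smul]
  module

theorem matNorm_ideal {x : X} (hx : S.HasAbsMatrixOrderUnitProperty x)
    (h1 : S.matNorm (amp 1 x) = 1) {n : ℕ+}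
    (y : Mat n n (S.toMatrixOrderedSpace.sub x hx.1)) (hy : y.IsHermitian) :
    (S.toMatrixOrderUnitSpace.ideal x hx.1).matNorm y = S.matNorm (emb y) := by
  have hy' := emb_isHermitian.2 hy
  obtain ⟨ε₀, hε₀, h₁, h₂⟩ := S.exists_of_dom hx.1 hy' fun i j => (y i j).2
  have habs := hx.2 n (emb y) hy' ⟨ε₀, hε₀, h₁, h₂⟩
  have hset : {ε : ℝ | 0 < ε ∧ blocks (amp n ((ε : ℂ) •
        (S.toMatrixOrderUnitSpace.ideal x hx.1).unit)) y yᴴ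
        (amp n ((ε : ℂ) • (S.toMatrixOrderUnitSpace.ideal x hx.1).unit)) ∈
        (S.toMatrixOrderUnitSpace.ideal x hx.1).pos (n + n)} =
      {ε : ℝ | 0 < ε ∧ blocks (amp n ((ε : ℂ) • x)) (emb y) (emb y)ᴴ
        (amp n ((ε : ℂ) • x)) ∈ S.pos (n + n)} := by
    ext ε
    refine and_congr_right fun _ => ?_
    change emb _ ∈ S.pos _ ↔ _
    rw [emb_blocks, emb_amp, emb_conjTranspose]
    rfl
  have hnn : 0 ≤ S.matNorm (emb y) := Real.sInf_nonneg fun ε hε => hε.1.le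
  apply le_antisymm
  · refine le_of_forall_pos_le_add fun k hk => ?_
    rw [MatrixOrderUnitSpace.matNorm, hset]
    refine csInf_le ⟨0, fun ε hε => hε.1.le⟩ ⟨by positivity, ?_⟩
    have hk' := S.amp_smul_mem n hx.1 hk.le
    have e : amp n (((S.matNorm (emb y) + k : ℝ) : ℂ) • x) =
        amp n ((S.matNorm (emb y) : ℂ) • x) + amp n ((k : ℂ) • x) := by
      ext a b
      by_cases h : a = b <;> simp [amp, h, add_smul]
    refine S.blocks_mem hy' ?_ ?_
    · rw [e]
      convert S.add_mem (S.add_mem habs (S.abs_add_mem hy')) hk' using 1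
      abel
    · rw [e]
      convert S.add_mem (S.add_mem habs (S.abs_sub_mem hy')) hk' using 1
      abel
  · rw [MatrixOrderUnitSpace.matNorm, MatrixOrderUnitSpace.matNorm, hset]
    refine csInf_le_csInf ⟨0, fun ε hε => hε.1.le⟩ ⟨ε₀, hε₀, S.blocks_mem hy' h₁ h₂⟩ ?_
    rintro ε ⟨hε, h⟩
    refine ⟨hε, ?_⟩
    convert S.add_mem h (S.amp_smul_mem (n + n) (S.unit_sub_mem hx.1 h1) hε.le) using 1
    rw [amp_add]
    apply mat_ext
    rintro (i | i) (j | j) <;> simp only [blocks_inl_inl, blocks_inl_inr, blocks_inr_inl,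
      blocks_inr_inr, Matrix.add_apply, dsum, Matrix.zero_apply, add_zero] <;>
      by_cases h : i = j <;> simp [amp, h, smul_sub]

/-- `X_x` as an absolute matrix order unit space, with the cones and absolute values of `X` and
the order unit `x`, for `x` of norm `1` with the absolute matrix order unit property. -/
def ideal (x : X) (hx : S.HasAbsMatrixOrderUnitProperty x) (h1 : S.matNorm (amp 1 x) = 1) :
    AbsMatrixOrderUnitSpace (S.toMatrixOrderedSpace.sub x hx.1) where
  toMatrixOrderUnitSpace := S.toMatrixOrderUnitSpace.ideal x hx.1
  abs y := Matrix.of fun i j => ⟨S.abs (emb y) i j, hx.abs_dom (fun a b => (y a b).2) i j⟩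
  abs_mem y := S.abs_mem (emb y)
  abs_of_pos h := emb_injective (S.abs_of_pos h)
  abs_add_mem h := S.abs_add_mem (emb_isHermitian.2 h)
  abs_sub_mem h := S.abs_sub_mem (emb_isHermitian.2 h)
  abs_smul k h := emb_injective (S.abs_smul k (emb_isHermitian.2 h))
  orth_of_le hu hv hw h h₁ h₂ := emb_injective (S.orth_of_le (emb_isHermitian.2 hu)
    (emb_isHermitian.2 hv) (emb_isHermitian.2 hw) (congrArg emb h) h₁ h₂)
  orth_abs_add hu hv hw h h' := emb_injective (S.orth_abs_add (emb_isHermitian.2 hu)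
    (emb_isHermitian.2 hv) (emb_isHermitian.2 hw) (congrArg emb h) (congrArg emb h'))
  orth_abs_sub hu hv hw h h' := emb_injective (S.orth_abs_sub (emb_isHermitian.2 hu)
    (emb_isHermitian.2 hv) (emb_isHermitian.2 hw) (congrArg emb h) (congrArg emb h'))
  abs_mul_le a y b := by
    have h := S.abs_mul_le a (emb y) b
    rw [← emb_rmul, ← emb_lmul] at h
    change (‖a‖ : ℂ) • S.abs (emb (rmul _ b)) - S.abs (emb (lmul a (rmul y b))) ∈ S.pos _
    rw [emb_rmul (x := x) _ b]
    exact h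
  abs_dsum y z := by
    refine emb_injective (Eq.trans ?_ (emb_dsum _ _).symm)
    change S.abs (emb (dsum y z)) = dsum (S.abs (emb y)) (S.abs (emb z))
    rw [emb_dsum, S.abs_dsum]
  orth_iff {n u v} hu hv := by
    have hu' := emb_isHermitian.1 (S.isHermitian_of_pos hu)
    refine (emb_injective.eq_iff (f := emb)).symm.trans ((S.orth_iff hu hv).trans ?_)
    have hs : ∀ (k : ℝ) (y : Mat n n (S.toMatrixOrderedSpace.sub x hx.1)), y.IsHermitian →
        ((k : ℂ) • y).IsHermitian := fun k y hy => by
      rw [Matrix.IsHermitian, Matrix.conjTranspose_smul, hy.eq]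
      simp
    have key : ∀ u₁ v₁ : Mat n n (S.toMatrixOrderedSpace.sub x hx.1), emb u₁ ∈ S.pos n →
        emb v₁ ∈ S.pos n → (S.OrthInf (emb u₁) (emb v₁) ↔
          (S.toMatrixOrderUnitSpace.ideal x hx.1).OrthInf u₁ v₁) := by
      intro u₁ v₁ h h'
      have h := emb_isHermitian.1 (S.isHermitian_of_pos h)
      have h' := emb_isHermitian.1 (S.isHermitian_of_pos h')
      refine forall_congr' fun α => forall_congr' fun β => ?_
      rw [S.matNorm_ideal hx h1 _ ((hs α _ h).add (hs β _ h')), S.matNorm_ideal hx h1 _ (hs α _ h),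
        S.matNorm_ideal hx h1 _ (hs β _ h')]
      rfl
    constructor
    · intro H u₁ v₁ h₁ h₂ h₃ h₄
      exact (key u₁ v₁ h₁ h₃).1 (H _ _ h₁ h₂ h₃ h₄)
    · intro H u₁ v₁ h₁ h₂ h₃ h₄
      obtain ⟨u₁, rfl⟩ := exists_emb (hx := hx.1) (S.dom_of_pos_le hx.1 h₁ h₂ fun i j => (u i j).2)
      obtain ⟨v₁, rfl⟩ := exists_emb (hx := hx.1) (S.dom_of_pos_le hx.1 h₃ h₄ fun i j => (v i j).2)
      exact (key u₁ v₁ h₁ h₃).2 (H _ _ h₁ h₂ h₃ h₄)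

variable {S} in
/-- The inclusion of the order projections of `X_x` into those of `X`: the same matrix,
regarded over `X`. -/
def OPInf.incl {x : X} {hx : S.HasAbsMatrixOrderUnitProperty x} {h1 : S.matNorm (amp 1 x) = 1}
    (hOP : ∀ (n : ℕ+) (p : Mat n n (S.toMatrixOrderedSpace.sub x hx.1)),
      (S.ideal x hx h1).IsOrderProj p → S.IsOrderProj (emb p))
    (p : (S.ideal x hx h1).OPInf) : S.OPInf where
  size := p.size
  mat := emb p.mat
  isOrderProj := hOP p.size p.mat p.isOrderProj

end AbsMatrixOrderUnitSpace

end AMOU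

/-!
The point is that `x` is itself an order projection, which is read off from `p = xⁿ ∈ M_n(X)`. Let
`2 p - e = a - b` be the orthogonal decomposition into positive and negative part. Orthogonality
and `b ≤ e + a` force `b ≤ e`, so `v = e - b = 2 p - a` lies between `0` and both `e` and `2 p`.
The absolute matrix order unit property gives `v ≤ ‖v‖ p ≤ p`, that is, `p ≤ a` and `e - p ≤ b`.
Hence `p ⊥ e - p`.

Now an order projection `p` of `X_x` satisfies `p ⊥ xⁿ - p`, and `p ≤ xⁿ ⊥ e - xⁿ`, so
`p ⊥ e - p`. Condition (T) passes to `X_x` because a matrix `w` has entries in `X_x` as soon as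
`|w|` and `|w⋆|` have. The map on `K₀` then comes from functoriality of the Grothendieck group,
and `[(p, q)] = 0` means `p ≈ q`.
-/

namespace AMOU

section Amplification

variable {X : Type*} [AddCommGroup X]

theorem amp_add_right (n : ℕ+) (y z : X) : amp n (y + z) = amp n y + amp n z :=
  (Matrix.diagonal_add _ _).symm

theorem amp_sub (n : ℕ+) (y z : X) : amp n (y - z) = amp n y - amp n z :=
  (Matrix.diagonal_sub _ _).symm

theorem amp_smul [Module ℂ X] (n : ℕ+) (c : ℂ) (y : X) : amp n (c • y) = c • amp n y :=
  Matrix.diagonal_smul c fun _ => y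

theorem amp_isHermitian [StarAddMonoid X] (n : ℕ+) {y : X} (hy : IsSelfAdjoint y) :
    (amp n y).IsHermitian :=
  Matrix.isHermitian_diagonal_of_self_adjoint _ (funext fun _ => hy)

theorem isHermitian_ofReal_smul [Module ℂ X] [StarAddMonoid X] [StarModule ℂ X] {n : ℕ+} (k : ℝ)
    {y : Mat n n X} (hy : y.IsHermitian) : ((k : ℂ) • y).IsHermitian := by
  rw [Matrix.IsHermitian, Matrix.conjTranspose_smul, hy.eq, Complex.star_def, Complex.conj_ofReal]

end Amplification

namespace MatrixOrderedSpace

variable {X : Type*} [AddCommGroup X] [Module ℂ X] [StarAddMonoid X] [StarModule ℂ X]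
  (S : MatrixOrderedSpace X) {n : ℕ+}

theorem sub_mem_trans {u v w : Mat n n X} (huv : v - u ∈ S.pos n) (hvw : w - v ∈ S.pos n) :
    w - u ∈ S.pos n := by
  simpa using S.add_mem hvw huv

theorem smul_mem_iff {k : ℝ} (hk : 0 < k) {v : Mat n n X} :
    (k : ℂ) • v ∈ S.pos n ↔ v ∈ S.pos n := by
  refine ⟨fun h => ?_, S.smul_mem hk.le⟩
  have h_inv := S.smul_mem (inv_pos.2 hk).le h
  rwa [smul_smul, ← Complex.ofReal_mul, inv_mul_cancel₀ hk.ne', Complex.ofReal_one, one_smul]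
    at h_inv

theorem smul_sub_smul_mem {p : Mat n n X} (hp : p ∈ S.pos n) {s t : ℝ} (hst : s ≤ t) :
    (t : ℂ) • p - (s : ℂ) • p ∈ S.pos n := by
  simpa [sub_smul] using S.smul_mem (sub_nonneg.2 hst) hp

theorem blocks_mem_iff {w y : Mat n n X} (hy : y.IsHermitian) :
    blocks w y yᴴ w ∈ S.pos (n + n) ↔ w + y ∈ S.pos n ∧ w - y ∈ S.pos n := by
  refine ⟨fun h => ⟨?_, ?_⟩, fun h => S.blocks_mem hy h.1 h.2⟩
  · simpa using S.of_blocks_mem hy h 1 (.inl rfl)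
  · simpa [sub_eq_add_neg] using S.of_blocks_mem hy h (-1) (.inr rfl)

end MatrixOrderedSpace

namespace MatrixOrderUnitSpace

variable {X : Type*} [AddCommGroup X] [Module ℂ X] [StarAddMonoid X] [StarModule ℂ X]
  (S : MatrixOrderUnitSpace X) {n : ℕ+}

theorem dom_unit_of_isSelfAdjoint {y : X} (hy : IsSelfAdjoint y) : S.Dom S.unit y := by
  obtain ⟨ε, hε, h_add, h_sub⟩ := S.order_unit y hy
  rw [amp_add_right] at h_add
  rw [amp_sub] at h_sub
  exact ⟨ε, hε, S.blocks_mem (amp_isHermitian 1 hy) h_add h_sub⟩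

theorem dom_unit (y : X) : S.Dom S.unit y := by
  rw [← realPart_add_I_smul_imaginaryPart y]
  exact S.dom_add (S.dom_unit_of_isSelfAdjoint (realPart y).2)
    (S.dom_smul S.unit_pos _ (S.dom_unit_of_isSelfAdjoint (imaginaryPart y).2))

theorem exists_smul_unit_bounds {y : Mat n n X} (hy : y.IsHermitian) :
    ∃ ε : ℝ, 0 < ε ∧ (ε : ℂ) • amp n S.unit + y ∈ S.pos n ∧
      (ε : ℂ) • amp n S.unit - y ∈ S.pos n := by
  simpa only [amp_smul] using S.exists_of_dom S.unit_pos hy fun i j => S.dom_unit (y i j)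

theorem smul_unit_add_mem_of_le {y : Mat n n X} {s t : ℝ} (hst : s ≤ t)
    (h : (s : ℂ) • amp n S.unit + y ∈ S.pos n) : (t : ℂ) • amp n S.unit + y ∈ S.pos n := by
  convert S.add_mem h (S.smul_sub_smul_mem (S.amp_mem n S.unit_pos) hst) using 1
  abel

theorem smul_unit_add_mem_of_forall_gt {y : Mat n n X} (hy : y.IsHermitian) {t : ℝ}
    (h : ∀ s, t < s → (s : ℂ) • amp n S.unit + y ∈ S.pos n) :
    (t : ℂ) • amp n S.unit + y ∈ S.pos n := by
  have he := S.amp_mem n S.unit_pos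
  refine S.archimedean he ((isHermitian_ofReal_smul t (S.isHermitian_of_pos he)).add hy)
    fun k hk => ?_
  convert h (k + t) (lt_add_of_pos_left t hk) using 1
  rw [Complex.ofReal_add, add_smul, add_assoc]

theorem matNorm_nonneg (y : Mat n n X) : 0 ≤ S.matNorm y :=
  Real.sInf_nonneg fun _ hε => hε.1.le

theorem matNorm_eq_sInf {y : Mat n n X} (hy : y.IsHermitian) :
    S.matNorm y = sInf {ε : ℝ | 0 < ε ∧ (ε : ℂ) • amp n S.unit + y ∈ S.pos n ∧
      (ε : ℂ) • amp n S.unit - y ∈ S.pos n} := by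
  simp only [matNorm, S.blocks_mem_iff hy, amp_smul]

theorem matNorm_le_iff {y : Mat n n X} (hy : y.IsHermitian) {t : ℝ} (ht : 0 ≤ t) :
    S.matNorm y ≤ t ↔ (t : ℂ) • amp n S.unit + y ∈ S.pos n ∧
      (t : ℂ) • amp n S.unit - y ∈ S.pos n := by
  rw [S.matNorm_eq_sInf hy]
  constructor
  · intro h
    have h_gt : ∀ s, t < s → (s : ℂ) • amp n S.unit + y ∈ S.pos n ∧
        (s : ℂ) • amp n S.unit + -y ∈ S.pos n := by
      intro s hs
      obtain ⟨ε, ⟨-, h_add, h_sub⟩, hεs⟩ :=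
        exists_lt_of_csInf_lt (S.exists_smul_unit_bounds hy) (h.trans_lt hs)
      rw [sub_eq_add_neg] at h_sub
      exact ⟨S.smul_unit_add_mem_of_le hεs.le h_add, S.smul_unit_add_mem_of_le hεs.le h_sub⟩
    rw [sub_eq_add_neg]
    exact ⟨S.smul_unit_add_mem_of_forall_gt hy fun s hs => (h_gt s hs).1,
      S.smul_unit_add_mem_of_forall_gt hy.neg fun s hs => (h_gt s hs).2⟩
  · rintro ⟨h_add, h_sub⟩
    refine le_of_forall_pos_le_add fun δ hδ => csInf_le ⟨0, fun ε hε => hε.1.le⟩ ?_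
    have htδ : t ≤ t + δ := le_add_of_nonneg_right hδ.le
    rw [sub_eq_add_neg] at h_sub
    refine ⟨add_pos_of_nonneg_of_pos ht hδ, S.smul_unit_add_mem_of_le htδ h_add, ?_⟩
    rw [sub_eq_add_neg]
    exact S.smul_unit_add_mem_of_le htδ h_sub

theorem matNorm_le_iff_of_pos {y : Mat n n X} (hy : y ∈ S.pos n) {t : ℝ} (ht : 0 ≤ t) :
    S.matNorm y ≤ t ↔ (t : ℂ) • amp n S.unit - y ∈ S.pos n := by
  rw [S.matNorm_le_iff (S.isHermitian_of_pos hy) ht, and_iff_right]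
  exact S.add_mem (S.smul_mem ht (S.amp_mem n S.unit_pos)) hy

theorem matNorm_smul_of_pos {k : ℝ} (hk : 0 < k) (y : Mat n n X) :
    S.matNorm ((k : ℂ) • y) = k * S.matNorm y := by
  rw [matNorm, matNorm, ← smul_eq_mul, ← Real.sInf_smul_of_nonneg hk.le]
  congr 1
  ext ε
  rw [Set.mem_smul_set_iff_inv_smul_mem₀ hk.ne', Set.mem_ofPred_eq, Set.mem_ofPred_eq, smul_eq_mul,
    mul_pos_iff_of_pos_left (inv_pos.2 hk)]
  refine and_congr_right fun _ => ?_
  rw [← S.smul_mem_iff hk (v := blocks _ y _ _)]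
  have hk' : (k : ℂ) ≠ 0 := by exact_mod_cast hk.ne'
  congr! 1
  apply mat_ext
  rintro (i | i) (j | j) <;> simp [amp_smul, smul_smul, hk', -Complex.coe_smul]

end MatrixOrderUnitSpace

namespace AbsMatrixOrderUnitSpace

variable {X : Type*} [AddCommGroup X] [Module ℂ X] [StarAddMonoid X] [StarModule ℂ X]
  {S : AbsMatrixOrderUnitSpace X} {n : ℕ+}

/-- `u ⊥ v`: the orthogonality of self-adjoint matrices defined by the absolute value. -/
def Orth (S : AbsMatrixOrderUnitSpace X) (u v : Mat n n X) : Prop := S.abs (u - v) = u + v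

theorem Orth.symm {u v : Mat n n X} (hu : u.IsHermitian) (hv : v.IsHermitian)
    (h : S.Orth u v) : S.Orth v u := by
  have h_neg := S.abs_smul (-1) (hu.sub hv)
  rw [Orth] at h ⊢
  simpa [h, add_comm] using h_neg

theorem Orth.mono_right {u v w : Mat n n X} (hu : u.IsHermitian) (h : S.Orth u v)
    (hw : w ∈ S.pos n) (hwv : v - w ∈ S.pos n) : S.Orth u w := by
  have hv : v ∈ S.pos n := by simpa using S.add_mem hwv hw
  exact S.orth_of_le hu (S.isHermitian_of_pos hv) (S.isHermitian_of_pos hw) h hw hwv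

theorem Orth.mono {u v u' v' : Mat n n X} (h : S.Orth u v) (hu' : u' ∈ S.pos n)
    (huu' : u - u' ∈ S.pos n) (hv' : v' ∈ S.pos n) (hvv' : v - v' ∈ S.pos n) : S.Orth u' v' := by
  have hu : u.IsHermitian := by
    simpa using (S.isHermitian_of_pos huu').add (S.isHermitian_of_pos hu')
  have hv'h := S.isHermitian_of_pos hv'
  exact ((h.mono_right hu hv' hvv').symm hu hv'h |>.mono_right hv'h hu' huu').symm hv'h
    (S.isHermitian_of_pos hu')

theorem Orth.add_right {u v w : Mat n n X} (hu : u.IsHermitian) (hv : v ∈ S.pos n)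
    (hw : w ∈ S.pos n) (huv : S.Orth u v) (huw : S.Orth u w) : S.Orth u (v + w) := by
  have h := S.orth_abs_add hu (S.isHermitian_of_pos hv) (S.isHermitian_of_pos hw) huv huw
  rwa [S.abs_of_pos (S.add_mem hv hw)] at h

theorem exists_orth_decomposition {y : Mat n n X} (hy : y.IsHermitian) :
    ∃ a ∈ S.pos n, ∃ b ∈ S.pos n, S.Orth a b ∧ a - b = y := by
  have h_half : (0 : ℝ) ≤ 1 / 2 := by norm_num
  have h_sub : ((1 / 2 : ℝ) : ℂ) • (S.abs y + y) - ((1 / 2 : ℝ) : ℂ) • (S.abs y - y) = y := by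
    push_cast
    module
  refine ⟨_, S.smul_mem h_half (S.abs_add_mem hy), _, S.smul_mem h_half (S.abs_sub_mem hy),
    ?_, h_sub⟩
  rw [Orth, h_sub]
  push_cast
  module

theorem matNorm_smul_add_of_orth {a b : Mat n n X} (ha : a ∈ S.pos n) (hb : b ∈ S.pos n)
    (hab : S.Orth a b) (c : ℝ) :
    S.matNorm ((c : ℂ) • a + b) = max (S.matNorm ((c : ℂ) • a)) (S.matNorm b) := by
  simpa using (S.orth_iff ha hb).1 hab a b ha (by simpa using S.zero_mem n) hb
    (by simpa using S.zero_mem n) c 1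

theorem matNorm_le_of_orth {a b : Mat n n X} (ha : a ∈ S.pos n) (hb : b ∈ S.pos n)
    (hab : S.Orth a b) {t : ℝ} (ht : 0 ≤ t) (h : (t : ℂ) • amp n S.unit + a - b ∈ S.pos n) :
    S.matNorm b ≤ t := by
  have ha₀ := S.matNorm_nonneg a
  rcases (S.matNorm_nonneg b).eq_or_lt with hb₀ | hb₀
  · rwa [← hb₀]
  -- `c` makes `‖c a‖ ≤ ‖b‖`, so that `‖c a + b‖ = ‖b‖`; adding `c a + b ≤ ‖b‖ e` to
  -- `c b ≤ c t e + c a` eliminates `a`.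
  obtain ⟨c, hc, hca⟩ : ∃ c : ℝ, 0 < c ∧ c * S.matNorm a ≤ S.matNorm b := by
    refine ⟨S.matNorm b / (S.matNorm a + 1), by positivity, ?_⟩
    rw [div_mul_eq_mul_div, div_le_iff₀ (by positivity)]
    nlinarith
  have hcab : S.matNorm ((c : ℂ) • a + b) ≤ S.matNorm b := by
    rw [matNorm_smul_add_of_orth ha hb hab, S.matNorm_smul_of_pos hc, max_eq_right hca]
  have h_sum := (S.matNorm_le_iff_of_pos (S.add_mem (S.smul_mem hc.le ha) hb) hb₀.le).1 hcab
  have h_le : S.matNorm (((1 + c : ℝ) : ℂ) • b) ≤ c * t + S.matNorm b := by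
    rw [S.matNorm_le_iff_of_pos (S.smul_mem (by positivity) hb) (by positivity)]
    convert S.add_mem (S.smul_mem hc.le h) h_sum using 1
    push_cast
    module
  rw [S.matNorm_smul_of_pos (by positivity)] at h_le
  nlinarith

theorem isOrderProj_iff_orth {p : Mat n n X} :
    S.IsOrderProj p ↔ p.IsHermitian ∧ S.Orth p (amp n S.unit - p) := by
  rw [IsOrderProj, Orth, add_sub_cancel, sub_sub_eq_add_sub, two_smul]

theorem IsOrderProj.unit_sub_mem {p : Mat n n X} (hp : S.IsOrderProj p) :
    amp n S.unit - p ∈ S.pos n := by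
  have he := S.isHermitian_of_pos (S.amp_mem n S.unit_pos)
  have h := S.abs_sub_mem ((isHermitian_ofReal_smul 2 hp.1).sub he)
  rw [Complex.ofReal_ofNat, hp.2] at h
  exact S.half_mem h (by module)

theorem IsOrderProj.of_orth_sub {p q : Mat n n X} (hq : S.IsOrderProj q) (hp : p ∈ S.pos n)
    (hpq : q - p ∈ S.pos n) (h : S.Orth p (q - p)) : S.IsOrderProj p := by
  have hph := S.isHermitian_of_pos hp
  have hpe : S.Orth p (amp n S.unit - q) :=
    (isOrderProj_iff_orth.1 hq).2.mono hp hpq hq.unit_sub_mem (by simpa using S.zero_mem n)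
  refine isOrderProj_iff_orth.2 ⟨hph, ?_⟩
  simpa using Orth.add_right hph hpq hq.unit_sub_mem h hpe

theorem isOrderProj_of_dominates {p : Mat n n X} (hp : p ∈ S.pos n)
    (hpe : amp n S.unit - p ∈ S.pos n)
    (h : ∀ u ∈ S.pos n, amp n S.unit - u ∈ S.pos n → ∀ k : ℝ, (k : ℂ) • p - u ∈ S.pos n →
      p - u ∈ S.pos n) :
    S.IsOrderProj p := by
  have hph := S.isHermitian_of_pos hp
  obtain ⟨a, ha, b, hb, hab, h_eq⟩ :=
    exists_orth_decomposition (hph.sub (S.isHermitian_of_pos hpe))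
  have hb_le : amp n S.unit - b ∈ S.pos n := by
    have hb_le_add : ((1 : ℝ) : ℂ) • amp n S.unit + a - b ∈ S.pos n := by
      rw [add_sub_assoc, h_eq, Complex.ofReal_one, one_smul]
      convert S.add_mem hp hp using 1
      abel
    simpa using (S.matNorm_le_iff_of_pos hb zero_le_one).1
      (matNorm_le_of_orth ha hb hab zero_le_one hb_le_add)
  have hv : amp n S.unit - b = ((2 : ℝ) : ℂ) • p - a := by
    rw [eq_sub_of_add_eq' (eq_add_of_sub_eq h_eq).symm, Complex.ofReal_ofNat]
    module
  have hvp : p - (amp n S.unit - b) ∈ S.pos n := by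
    refine h _ hb_le (by simpa using hb) 2 ?_
    rwa [hv, sub_sub_cancel]
  refine isOrderProj_iff_orth.2 ⟨hph, hab.mono hp ?_ hpe ?_⟩
  · rw [hv, Complex.ofReal_ofNat] at hvp
    convert hvp using 1
    module
  · convert hvp using 1
    abel

theorem HasAbsMatrixOrderUnitProperty.isOrderProj_amp {x : X}
    (hx : S.HasAbsMatrixOrderUnitProperty x) (h1 : S.matNorm (amp 1 x) = 1) (n : ℕ+) :
    S.IsOrderProj (amp n x) := by
  have hxp := S.amp_mem n hx.1
  have hxe : amp n S.unit - amp n x ∈ S.pos n := by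
    rw [← amp_sub]
    exact S.amp_mem n (S.unit_sub_mem hx.1 h1)
  refine isOrderProj_of_dominates hxp hxe fun u hu hue k huk => ?_
  have hu_norm : S.matNorm u ≤ 1 :=
    (S.matNorm_le_iff_of_pos hu zero_le_one).2 (by simpa using hue)
  have hu_le : amp n (((|k| + 1 : ℝ) : ℂ) • x) - u ∈ S.pos n := by
    rw [amp_smul]
    exact S.sub_mem_trans huk (S.smul_sub_smul_mem hxp (by linarith [le_abs_self k]))
  have h_abs := hx.2 n u (S.isHermitian_of_pos hu)
    ⟨|k| + 1, by positivity, S.add_mem (S.amp_smul_mem n hx.1 (by positivity)) hu, hu_le⟩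
  rw [S.abs_of_pos hu, amp_smul] at h_abs
  simpa using S.sub_mem_trans h_abs (S.smul_sub_smul_mem hxp hu_norm)

theorem dom_of_dom_abs_of_isHermitian {x : X} (hx : amp 1 x ∈ S.pos 1) {z : Mat n n X}
    (hz : z.IsHermitian) (h : ∀ i j, S.Dom x (S.abs z i j)) (i j : Idx n) : S.Dom x (z i j) := by
  obtain ⟨ε, hε, -, hle⟩ := S.exists_of_dom hx (S.isHermitian_of_pos (S.abs_mem z)) h
  refine S.dom_of_le hz hε ?_ ?_ i j
  · convert S.add_mem hle (S.abs_add_mem hz) using 1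
    abel
  · exact S.sub_mem_trans (S.abs_sub_mem hz) hle

theorem dom_of_dom_abs {x : X} (hx : amp 1 x ∈ S.pos 1) {l m : ℕ+} {w : Mat l m X}
    (h : ∀ i j, S.Dom x (S.abs w i j)) (h' : ∀ i j, S.Dom x (S.abs wᴴ i j)) (i : Idx l)
    (j : Idx m) : S.Dom x (w i j) := by
  have hz : (blocks 0 w wᴴ 0).IsHermitian := by simp [Matrix.IsHermitian, blocks_conjTranspose]
  have h_abs : ∀ i j, S.Dom x (S.abs (blocks 0 w wᴴ 0) i j) := by
    rw [S.abs_blocks, (sumEquiv l m).forall_congr_right.symm]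
    intro i
    rw [(sumEquiv l m).forall_congr_right.symm]
    intro j
    rcases i with i | i <;> rcases j with j | j <;> simp [dsum, S.dom_zero hx, h, h']
  simpa using dom_of_dom_abs_of_isHermitian hx hz h_abs (sumEquiv l m (.inl i))
    (sumEquiv l m (.inr j))

section Ideal

variable {x : X} {hx : S.HasAbsMatrixOrderUnitProperty x} {h1 : S.matNorm (amp 1 x) = 1}

theorem Orth.emb {u v : Mat n n (S.toMatrixOrderedSpace.sub x hx.1)}
    (h : (S.ideal x hx h1).Orth u v) : S.Orth (emb u) (emb v) :=
  congrArg AMOU.emb h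

theorem IsOrderProj.emb {p : Mat n n (S.toMatrixOrderedSpace.sub x hx.1)}
    (hp : (S.ideal x hx h1).IsOrderProj p) : S.IsOrderProj (emb p) := by
  have h_unit : AMOU.emb (amp n (S.ideal x hx h1).unit - p) = amp n x - AMOU.emb p := by
    rw [emb_sub, emb_amp]
    rfl
  have hpx : amp n x - AMOU.emb p ∈ S.pos n := h_unit ▸ hp.unit_sub_mem
  refine (hx.isOrderProj_amp h1 n).of_orth_sub (hp.mem (S.ideal x hx h1)) hpx ?_
  exact h_unit ▸ (isOrderProj_iff_orth.1 hp).2.emb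

theorem IsPartialIso.emb {m n : ℕ+} {v : Mat m n (S.toMatrixOrderedSpace.sub x hx.1)}
    (hv : (S.ideal x hx h1).IsPartialIso v) : S.IsPartialIso (emb v) :=
  ⟨hv.1.emb, hv.2.emb⟩

theorem CondT.ideal (hT : S.CondT) (hx : S.HasAbsMatrixOrderUnitProperty x)
    (h1 : S.matNorm (amp 1 x) = 1) : (S.ideal x hx h1).CondT := by
  intro l m n u v hu hv huv
  obtain ⟨w, -, hw_star, hw⟩ := hT l m n (AMOU.emb u) (AMOU.emb v) hu.emb hv.emb
    (congrArg AMOU.emb huv)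
  obtain ⟨w, rfl⟩ : ∃ w' : Mat m l (S.toMatrixOrderedSpace.sub x hx.1), AMOU.emb w' = w := by
    refine exists_emb (dom_of_dom_abs hx.1 (fun i j => ?_) fun i j => ?_)
    · rw [hw]
      exact ((S.ideal x hx h1).abs vᴴ i j).2
    · rw [hw_star]
      exact ((S.ideal x hx h1).abs uᴴ i j).2
  have hw_star' : (S.ideal x hx h1).abs wᴴ = (S.ideal x hx h1).abs uᴴ := emb_injective hw_star
  have hw' : (S.ideal x hx h1).abs w = (S.ideal x hx h1).abs vᴴ := emb_injective hw
  exact ⟨w, ⟨hw' ▸ hv.2, hw_star' ▸ hu.2⟩, hw_star', hw'⟩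

theorem PIEquiv.incl {hOP : ∀ (n : ℕ+) (p : Mat n n (S.toMatrixOrderedSpace.sub x hx.1)),
      (S.ideal x hx h1).IsOrderProj p → S.IsOrderProj (emb p)}
    {p q : (S.ideal x hx h1).OPInf} (h : PIEquiv p q) : PIEquiv (p.incl hOP) (q.incl hOP) := by
  obtain ⟨v, hp, hq⟩ := h
  exact ⟨emb v, congrArg emb hp, congrArg emb hq⟩

variable (hOP : ∀ (n : ℕ+) (p : Mat n n (S.toMatrixOrderedSpace.sub x hx.1)),
    (S.ideal x hx h1).IsOrderProj p → S.IsOrderProj (emb p))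

theorem OPInf.incl_sum (p q : (S.ideal x hx h1).OPInf) :
    (p.sum q).incl hOP = (p.incl hOP).sum (q.incl hOP) := by
  simp only [OPInf.incl, OPInf.sum, emb_dsum]

/-- The homomorphism between the monoids of classes of order projections that is induced by the
inclusion of `X_x` into `X`. -/
def OPClass.inclHom (hTx : (S.ideal x hx h1).CondT) (hT : S.CondT) :
    OPClass hTx →+ OPClass hT where
  toFun := Quotient.map (OPInf.incl hOP) fun _ _ h => h.incl
  map_zero' := rfl
  map_add' := by
    rintro ⟨p⟩ ⟨q⟩
    exact congrArg (OPClass.mk hT) (OPInf.incl_sum hOP p q)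

end Ideal

section Functoriality

variable {Y : Type*} [AddCommGroup Y] [Module ℂ Y] [StarAddMonoid Y] [StarModule ℂ Y]
  {S' : AbsMatrixOrderUnitSpace Y} {hT : S.CondT} {hT' : S'.CondT}

theorem K0.exists_eq_mk (z : K0 hT) : ∃ p q, z = K0.mk hT p q := by
  induction z using AddLocalization.ind with
  | H y =>
    obtain ⟨⟨p⟩, ⟨q⟩, hq⟩ := y
    exact ⟨p, q, rfl⟩

theorem stableEquiv_iff_exists_add (hT : S.CondT) {p q : S.OPInf} :
    StableEquiv p q ↔ ∃ c, c + OPClass.mk hT p = c + OPClass.mk hT q := by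
  simp only [add_comm _ (OPClass.mk hT _)]
  constructor
  · rintro ⟨r, h⟩
    exact ⟨OPClass.mk hT r, Quotient.sound h⟩
  · rintro ⟨⟨r⟩, h⟩
    exact ⟨r, Quotient.exact h⟩

theorem K0.mk_eq_zero_iff {p q : S.OPInf} : K0.mk hT p q = 0 ↔ StableEquiv p q := by
  rw [stableEquiv_iff_exists_add hT, K0.mk, ← AddLocalization.mk_zero,
    AddLocalization.mk_eq_mk_iff, AddLocalization.r_iff_exists]
  simp

/-- The homomorphism of `K₀`-groups induced by a homomorphism of the monoids of classes of order
projections. -/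
noncomputable def K0.map (f : OPClass hT →+ OPClass hT') : K0 hT →+ K0 hT' :=
  (AddLocalization.addMonoidOf ⊤).map (T := ⊤) (g := f) (fun _ => AddSubmonoid.mem_top _)
    (AddLocalization.addMonoidOf ⊤)

variable {f : OPClass hT →+ OPClass hT'} {φ : S.OPInf → S'.OPInf}

theorem K0.map_mk (hφ : ∀ p, f (OPClass.mk hT p) = OPClass.mk hT' (φ p)) (p q : S.OPInf) :
    K0.map f (K0.mk hT p q) = K0.mk hT' (φ p) (φ q) := by
  simp only [K0.map, K0.mk, AddLocalization.mk_eq_addMonoidOf_mk', ← hφ,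
    AddSubmonoid.LocalizationMap.map_mk']

theorem K0.map_injective (hφ : ∀ p, f (OPClass.mk hT p) = OPClass.mk hT' (φ p))
    (h : ∀ p q, StableEquiv (φ p) (φ q) → StableEquiv p q) : Function.Injective (K0.map f) := by
  refine (injective_iff_map_eq_zero _).2 fun z hz => ?_
  obtain ⟨p, q, rfl⟩ := K0.exists_eq_mk z
  rw [K0.map_mk hφ, K0.mk_eq_zero_iff] at hz
  exact K0.mk_eq_zero_iff.2 (h p q hz)

end Functoriality

end AbsMatrixOrderUnitSpace

end AMOU

theorem mainTheorem3 {X : Type*} [AddCommGroup X] [Module ℂ X] [StarAddMonoid X] [StarModule ℂ X]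
    (S : AMOU.AbsMatrixOrderUnitSpace X) (hT : S.CondT) (x : X)
    (hx : S.HasAbsMatrixOrderUnitProperty x) (h1 : S.matNorm (AMOU.amp 1 x) = 1) :
    ∃ (hTx : (S.ideal x hx h1).CondT)
      (hOP : ∀ (n : ℕ+) (p : AMOU.Mat n n (S.toMatrixOrderedSpace.sub x hx.1)),
        (S.ideal x hx h1).IsOrderProj p → S.IsOrderProj (AMOU.emb p))
      (f : AMOU.AbsMatrixOrderUnitSpace.K0 hTx →+ AMOU.AbsMatrixOrderUnitSpace.K0 hT),
      (∀ p q : (S.ideal x hx h1).OPInf,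
        f (AMOU.AbsMatrixOrderUnitSpace.K0.mk hTx p q) =
          AMOU.AbsMatrixOrderUnitSpace.K0.mk hT (p.incl hOP) (q.incl hOP)) ∧
      ((∀ p q : (S.ideal x hx h1).OPInf,
          AMOU.AbsMatrixOrderUnitSpace.StableEquiv (p.incl hOP) (q.incl hOP) →
            AMOU.AbsMatrixOrderUnitSpace.StableEquiv p q) →
        Function.Injective f) := by
  have hOP : ∀ (n : ℕ+) (p : AMOU.Mat n n (S.toMatrixOrderedSpace.sub x hx.1)),
      (S.ideal x hx h1).IsOrderProj p → S.IsOrderProj (AMOU.emb p) := fun _ _ hp => hp.emb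
  have hTx : (S.ideal x hx h1).CondT := hT.ideal hx h1
  let f := AMOU.AbsMatrixOrderUnitSpace.OPClass.inclHom hOP hTx hT
  have hf : ∀ p : (S.ideal x hx h1).OPInf, f (AMOU.AbsMatrixOrderUnitSpace.OPClass.mk hTx p) =
      AMOU.AbsMatrixOrderUnitSpace.OPClass.mk hT (p.incl hOP) := fun _ => rfl
  exact ⟨hTx, hOP, AMOU.AbsMatrixOrderUnitSpace.K0.map f,
    AMOU.AbsMatrixOrderUnitSpace.K0.map_mk hf, AMOU.AbsMatrixOrderUnitSpace.K0.map_injective hf⟩
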